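/- Let $k$ be an algebraically closed field and let $\Lambda$ be a finite dimensional $k$-algebra. Write $\operatorname{mod}\Lambda$ for the category of finitely generated right $\Lambda$-modules. For $T\in\operatorname{mod}\Lambda$, let $\operatorname{add}T$ be the class of modules isomorphic to finite direct sums of direct summands of $T$, and let $\operatorname{Gen}T$ be the class of all $M\in\operatorname{mod}\Lambda$ admitting an epimorphism $T^d\to M$ for some integer $d\ge 0$. A module $T\in\operatorname{mod}\Lambda$ is *tilting* if $\operatorname{pd}_\Lambda T\le 1$, $\operatorname{Ext}^1_\Lambda(T,T)=0$, and there is a short exact sequence $0\to\Lambda_\Lambda\to T'\to T''\to 0$ with $T',T''\in\operatorname{add}T$. A tilting module $T$ is *separating* if its induced torsion pair $(\mathcal T(T),\mathcal F(T))$, where $$\mathcal T(T)=\{M\in\operatorname{mod}\Lambda\mid \operatorname{Ext}^1_\Lambda(T,M)=0\},\qquad \mathcal F(T)=\{M\in\operatorname{mod}\Lambda\mid \operatorname{Hom}_\Lambda(T,M)=0\},$$ is splitting, i.e. every indecomposable module in $\operatorname{mod}\Lambda$ belongs to $\mathcal T(T)$ or to $\mathcal F(T)$. A tilting module $T$ has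 the *hereditary property* if for every $M\in\operatorname{Gen}T$ there is a short exact sequence $0\to T'\to T''\to M\to 0$ with $T',T''\in\operatorname{add}T$. Suppose that there exists a separating tilting $\Lambda$-module $T$ that has the hereditary property. Then $\operatorname{gl.dim}\Lambda\le 2$, where $\operatorname{gl.dim}\Lambda$ is the supremum of the projective dimensions of all right $\Lambda$-modules. -/

import Mathlib

open CategoryTheory

universe u v

/-- The category of all right `Λ`-modules, i.e. modules over the opposite ring. The category
`mod Λ` is its full subcategory of modules `M` with `Module.Finite Λᵐᵒᵖ M`. -/
abbrev RightMod (Λ : Type u) [Ring Λ] : Type (u + 1) := ModuleCat.{u} Λᵐᵒᵖ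

namespace RightMod

section

variable {Λ : Type u} [Ring Λ]

/-- There is a short exact sequence `0 → A → B → C → 0`. -/
def ExistsShortExact (A B C : RightMod Λ) : Prop :=
  ∃ (f : A ⟶ B) (g : B ⟶ C) (w : f ≫ g = 0), (ShortComplex.mk f g w).ShortExact

/-- `X` belongs to `add T`: it is isomorphic to a finite direct sum of direct summands of `T`. -/
def InAdd (T X : RightMod Λ) : Prop :=
  ∃ (n : ℕ) (N : Fin n → Submodule Λᵐᵒᵖ T),
    (∀ i, IsComplemented (N i)) ∧ Nonempty (X ≃ₗ[Λᵐᵒᵖ] (∀ i, N i))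

/-- `X` belongs to `Gen T`: it is finitely generated and there is an epimorphism `T ^ d → X`
for some integer `d ≥ 0`. -/
def InGen (T X : RightMod Λ) : Prop :=
  Module.Finite Λᵐᵒᵖ X ∧
    ∃ (d : ℕ) (p : (Fin d → T) →ₗ[Λᵐᵒᵖ] X), Function.Surjective p

/-- `T` is a (finitely generated, classical) tilting right `Λ`-module. -/
structure IsTilting (T : RightMod Λ) : Prop where
  finite : Module.Finite Λᵐᵒᵖ T
  projectiveDimension_le : projectiveDimension T ≤ 1
  ext_self : Subsingleton (Abelian.Ext T T 1)
  /-- There is `0 → Λ_Λ → T' → T'' → 0` with `T'` and `T''` in `add T`. -/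
  coresolution : ∃ T' T'' : RightMod Λ, InAdd T T' ∧ InAdd T T'' ∧
    ExistsShortExact (ModuleCat.of Λᵐᵒᵖ Λ) T' T''

/-- The torsion class `𝒯(T) = {M ∈ mod Λ | Ext¹(T, M) = 0}`. -/
def torsionClass (T : RightMod Λ) : ObjectProperty (RightMod Λ) :=
  fun M => Module.Finite Λᵐᵒᵖ M ∧ Subsingleton (Abelian.Ext T M 1)

/-- The torsion-free class `ℱ(T) = {M ∈ mod Λ | Hom(T, M) = 0}`. -/
def torsionFreeClass (T : RightMod Λ) : ObjectProperty (RightMod Λ) :=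
  fun M => Module.Finite Λᵐᵒᵖ M ∧ ∀ f : T ⟶ M, f = 0

/-- A pair of classes in `mod Λ` is splitting if every indecomposable module of `mod Λ` belongs to
one of the two. -/
def IsSplitting (𝒯 ℱ : ObjectProperty (RightMod Λ)) : Prop :=
  ∀ M : RightMod Λ, Module.Finite Λᵐᵒᵖ M → Indecomposable M → 𝒯 M ∨ ℱ M

/-- `T` is separating if the pair `(𝒯(T), ℱ(T))` is splitting. -/
def IsSeparating (T : RightMod Λ) : Prop :=
  IsSplitting (torsionClass T) (torsionFreeClass T)

/-- The hereditary property: every `M ∈ Gen T` has a short exact sequence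
`0 → T' → T'' → M → 0` with `T'` and `T''` in `add T`. -/
def HasHereditaryProperty (T : RightMod Λ) : Prop :=
  ∀ M : RightMod Λ, InGen T M →
    ∃ T' T'' : RightMod Λ, InAdd T T' ∧ InAdd T T'' ∧ ExistsShortExact T' T'' M

end

/-- The (right) global dimension of `Λ`: the supremum of the projective dimensions of all right
`Λ`-modules. The zero module has projective dimension `⊥`. -/
noncomputable def globalDimension (Λ : Type u) [Ring Λ] : WithBot ℕ∞ :=
  ⨆ M : RightMod Λ, projectiveDimension M

end RightMod

/-! Since the torsion pair splits, a finitely generated module is `A ⊕ B` with `A` generated by `T`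
and `Hom(T, B) = 0` (`IsTilting.exists_decomposition`). The hereditary property resolves `A` by
modules in `add T`, which have projective dimension at most 1, so `pd A ≤ 2`.

In fact `pd B ≤ 1`. Embed a finitely generated `N` in a finitely generated injective `I`. Then
`Ext²(B, N) ≅ Ext¹(B, I/N)`, and `I/N` is torsion because `Ext¹(T, I/N) ≅ Ext²(T, N) = 0`. An
extension of a torsion-free module by a torsion module splits: its middle term decomposes, and the
absence of maps from generated to torsion-free modules forces the kernel into the generated summand
and that summand into the kernel (`IsTilting.ext_one_eq_zero`).

Baer's criterion carries the bound from finitely generated modules to all modules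
(`hasProjectiveDimensionLT_three_of_finite`). -/

namespace RightMod

/-! ### Modules generated by `T` and splitting of extensions -/

section Generation

variable {R : Type*} [Ring R]

/-- `X` is generated by `T`: the images of the homomorphisms `T → X` span `X`. -/
def IsGeneratedBy (R : Type*) [Ring R] (T X : Type*) [AddCommGroup T] [Module R T]
    [AddCommGroup X] [Module R X] : Prop :=
  ⨆ f : T →ₗ[R] X, LinearMap.range f = ⊤

variable {T X Y : Type*} [AddCommGroup T] [Module R T] [AddCommGroup X] [Module R X]
  [AddCommGroup Y] [Module R Y]

lemma IsGeneratedBy.of_surjective (h : IsGeneratedBy R T X) (g : X →ₗ[R] Y)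
    (hg : Function.Surjective g) : IsGeneratedBy R T Y := by
  rw [IsGeneratedBy, eq_top_iff, ← LinearMap.range_eq_top.2 hg, LinearMap.range_eq_map, ← h,
    Submodule.map_iSup]
  refine iSup_le fun f => ?_
  rw [← LinearMap.range_comp]
  exact le_iSup (fun f : T →ₗ[R] Y => LinearMap.range f) (g ∘ₗ f)

lemma IsGeneratedBy.map_le (h : IsGeneratedBy R T X) (g : X →ₗ[R] Y) :
    LinearMap.range g ≤ ⨆ f : T →ₗ[R] Y, LinearMap.range f := by
  rw [LinearMap.range_eq_map, ← h, Submodule.map_iSup]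
  refine iSup_le fun f => ?_
  rw [← LinearMap.range_comp]
  exact le_iSup (fun f : T →ₗ[R] Y => LinearMap.range f) (g ∘ₗ f)

lemma IsGeneratedBy.prod (hX : IsGeneratedBy R T X) (hY : IsGeneratedBy R T Y) :
    IsGeneratedBy R T (X × Y) := by
  rw [IsGeneratedBy, eq_top_iff, ← LinearMap.sup_range_inl_inr]
  exact sup_le (hX.map_le _) (hY.map_le _)

lemma IsGeneratedBy.eq_zero (h : IsGeneratedBy R T X) (hY : ∀ f : T →ₗ[R] Y, f = 0)
    (g : X →ₗ[R] Y) : g = 0 := by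
  rw [← LinearMap.range_eq_bot, eq_bot_iff]
  refine (h.map_le g).trans (iSup_le fun f => ?_)
  rw [hY f, LinearMap.range_zero]

lemma IsGeneratedBy.exists_surjective [Module.Finite R X] (h : IsGeneratedBy R T X) :
    ∃ (d : ℕ) (p : (Fin d → T) →ₗ[R] X), Function.Surjective p := by
  -- A finitely generated module is a compact element of its submodule lattice, so finitely many
  -- images already span.
  obtain ⟨s, hs⟩ := CompleteLattice.IsCompactElement.exists_finset_of_le_iSup _
    ((Submodule.fg_iff_compact _).1 (Module.Finite.fg_top (R := R) (M := X)))
    (fun f : T →ₗ[R] X => LinearMap.range f) h.ge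
  let e := s.equivFin
  refine ⟨s.card, LinearMap.lsum R (fun _ => T) ℕ fun i => (e.symm i : T →ₗ[R] X), ?_⟩
  rw [← LinearMap.range_eq_top, eq_top_iff]
  refine hs.trans (iSup₂_le fun f hf => ?_)
  rintro _ ⟨t, rfl⟩
  refine ⟨Pi.single (e ⟨f, hf⟩) t, ?_⟩
  rw [LinearMap.lsum_piSingle, Equiv.symm_apply_apply]

/-- If `E` is the sum of a module generated by `T` and of a module with no nonzero homomorphism
from `T`, then a surjection of `E` onto a module of the second kind splits whenever its kernel is
generated by `T`. -/
lemma exists_rightInverse_of_isGeneratedBy {E F A B : Type*}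
    [AddCommGroup E] [Module R E] [AddCommGroup F] [Module R F]
    [AddCommGroup A] [Module R A] [AddCommGroup B] [Module R B]
    (e : E ≃ₗ[R] A × B) (hA : IsGeneratedBy R T A) (hB : ∀ f : T →ₗ[R] B, f = 0)
    (hF : ∀ f : T →ₗ[R] F, f = 0) (q : E →ₗ[R] F) (hq : Function.Surjective q)
    (hK : IsGeneratedBy R T (LinearMap.ker q)) :
    ∃ s : F →ₗ[R] E, q ∘ₗ s = LinearMap.id := by
  -- The kernel is generated by `T`, so its projection to `B` vanishes; hence that projection
  -- descends to `F ≅ E / ker q`.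
  have h1 : LinearMap.ker q ≤ LinearMap.ker (LinearMap.snd R A B ∘ₗ e.toLinearMap) := by
    intro x hx
    exact LinearMap.congr_fun
      (hK.eq_zero hB ((LinearMap.snd R A B ∘ₗ e.toLinearMap) ∘ₗ (LinearMap.ker q).subtype)) ⟨x, hx⟩
  -- Conversely `q` kills `A`, so the `B`-component of any preimage is again a preimage; this gives
  -- the section.
  have h2 : ∀ a, q (e.symm (a, 0)) = 0 := fun a => LinearMap.congr_fun
    (hA.eq_zero hF (q ∘ₗ e.symm.toLinearMap ∘ₗ LinearMap.inl R A B)) a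
  refine ⟨e.symm.toLinearMap ∘ₗ LinearMap.inr R A B ∘ₗ (LinearMap.ker q).liftQ _ h1 ∘ₗ
    (q.quotKerEquivOfSurjective hq).symm.toLinearMap, ?_⟩
  ext y
  obtain ⟨x, rfl⟩ := hq y
  have h3 : (q.quotKerEquivOfSurjective hq).symm (q x) = (LinearMap.ker q).mkQ x := by
    rw [LinearEquiv.symm_apply_eq]; rfl
  have h4 : x = e.symm ((e x).1, 0) + e.symm (0, (e x).2) := by
    rw [← map_add]; simp
  have h5 : q x = q (e.symm (0, (e x).2)) := by
    conv_lhs => rw [h4]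
    rw [map_add, h2, zero_add]
  simp [h3, h5.symm]

/-- Homomorphisms from a module `F` with no nonzero homomorphism from `T` lift along a surjection
whose kernel is generated by `T`, if the pullback decomposes. -/
lemma exists_lift_of_isGeneratedBy {I C F A B : Type*}
    [AddCommGroup I] [Module R I] [AddCommGroup C] [Module R C]
    [AddCommGroup F] [Module R F]
    [AddCommGroup A] [Module R A] [AddCommGroup B] [Module R B]
    (p : I →ₗ[R] C) (hp : Function.Surjective p) (hK : IsGeneratedBy R T (LinearMap.ker p))
    (g : F →ₗ[R] C) (hF : ∀ f : T →ₗ[R] F, f = 0)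
    (e : LinearMap.eqLocus (p ∘ₗ LinearMap.fst R I F) (g ∘ₗ LinearMap.snd R I F) ≃ₗ[R] A × B)
    (hA : IsGeneratedBy R T A) (hB : ∀ f : T →ₗ[R] B, f = 0) :
    ∃ l : F →ₗ[R] I, p ∘ₗ l = g := by
  -- `E` is the pullback of `p` and `g`; a section of its projection to `F` is the same as a lift of
  -- `g`.
  let E := LinearMap.eqLocus (p ∘ₗ LinearMap.fst R I F) (g ∘ₗ LinearMap.snd R I F)
  let q : E →ₗ[R] F := LinearMap.snd R I F ∘ₗ E.subtype
  have hq : Function.Surjective q := fun y => by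
    obtain ⟨x, hx⟩ := hp (g y)
    exact ⟨⟨(x, y), hx⟩, rfl⟩
  let c : LinearMap.ker p →ₗ[R] LinearMap.ker q :=
    { toFun := fun x => ⟨⟨(x, 0), (x.2 : p x = 0).trans (map_zero g).symm⟩, rfl⟩
      map_add' := fun x y => by ext <;> simp
      map_smul' := fun r x => by ext <;> simp }
  have hc : Function.Surjective c := by
    rintro ⟨⟨⟨x, y⟩, hxy⟩, hy⟩
    obtain rfl : y = 0 := hy
    exact ⟨⟨x, (hxy : p x = g 0).trans (map_zero g)⟩, rfl⟩
  obtain ⟨s, hs⟩ := exists_rightInverse_of_isGeneratedBy e hA hB hF q hq (hK.of_surjective c hc)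
  refine ⟨LinearMap.fst R I F ∘ₗ E.subtype ∘ₗ s, ?_⟩
  ext y
  have h1 : p (s y).1.1 = g (s y).1.2 := (s y).2
  have h2 : (s y).1.2 = y := LinearMap.congr_fun hs y
  simpa [h2] using h1

end Generation

/-! ### Decomposition by induction on length -/

section Decomposition

variable {R : Type u} [Ring R] [IsArtinianRing R]

/-- A module over an artinian ring decomposes into a member of `P` and a member of `Q` if its
indecomposable summands lie in `P` or in `Q`, and both classes are closed under direct sums. -/
lemma exists_prod_of_indecomposable (P Q : ObjectProperty (ModuleCat.{u} R))
    (hP0 : ∀ X : ModuleCat.{u} R, Subsingleton X → P X)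
    (hQ0 : ∀ X : ModuleCat.{u} R, Subsingleton X → Q X)
    (hP : ∀ X Y : ModuleCat.{u} R, P X → P Y → P (ModuleCat.of R (X × Y)))
    (hQ : ∀ X Y : ModuleCat.{u} R, Q X → Q Y → Q (ModuleCat.of R (X × Y)))
    (hPQ : ∀ X : ModuleCat.{u} R, Module.Finite R X → Indecomposable X → P X ∨ Q X)
    (E : ModuleCat.{u} R) (hE : Module.Finite R E) :
    ∃ A B : ModuleCat.{u} R, P A ∧ Q B ∧ Nonempty (E ≃ₗ[R] A × B) := by
  obtain ⟨n, hn⟩ := ENat.ne_top_iff_exists.1 (Module.length_ne_top (R := R) (M := E))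
  induction n using Nat.strong_induction_on generalizing E with
  | _ n ih =>
  let O := ModuleCat.of R PUnit.{u + 1}
  by_cases h0 : Limits.IsZero E
  · rw [ModuleCat.isZero_iff_subsingleton] at h0
    exact ⟨O, O, hP0 _ inferInstance, hQ0 _ inferInstance,
      ⟨LinearEquiv.ofSubsingleton _ _⟩⟩
  by_cases h1 : Indecomposable E
  · rcases hPQ E hE h1 with h | h
    · exact ⟨E, O, h, hQ0 _ inferInstance, ⟨LinearEquiv.prodUnique.symm⟩⟩
    · exact ⟨O, E, hP0 _ inferInstance, h, ⟨LinearEquiv.uniqueProd.symm⟩⟩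
  · simp only [Indecomposable, not_and, not_forall, not_or] at h1
    obtain ⟨Y, Z, i, hY, hZ⟩ := h1 h0
    rw [ModuleCat.isZero_iff_subsingleton, not_subsingleton_iff_nontrivial] at hY hZ
    let e : E ≃ₗ[R] Y × Z := (i ≪≫ ModuleCat.biprodIsoProd Y Z).toLinearEquiv
    have hYf : Module.Finite R Y := Module.Finite.of_surjective
      (LinearMap.fst R Y Z ∘ₗ e.toLinearMap) (Prod.fst_surjective.comp e.surjective)
    have hZf : Module.Finite R Z := Module.Finite.of_surjective
      (LinearMap.snd R Y Z ∘ₗ e.toLinearMap) (Prod.snd_surjective.comp e.surjective)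
    obtain ⟨a, ha⟩ := ENat.ne_top_iff_exists.1 (Module.length_ne_top (R := R) (M := Y))
    obtain ⟨b, hb⟩ := ENat.ne_top_iff_exists.1 (Module.length_ne_top (R := R) (M := Z))
    have hl := e.length_eq
    have hYp := Module.length_pos (R := R) (M := Y)
    have hZp := Module.length_pos (R := R) (M := Z)
    rw [Module.length_prod, ← hn, ← ha, ← hb] at hl
    rw [← ha] at hYp
    rw [← hb] at hZp
    norm_cast at hl hYp hZp
    obtain ⟨A, B, hA, hB, ⟨f⟩⟩ := ih a (by lia) Y hYf ha
    obtain ⟨A', B', hA', hB', ⟨f'⟩⟩ := ih b (by lia) Z hZf hb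
    exact ⟨_, _, hP _ _ hA hA', hQ _ _ hB hB',
      ⟨e.trans ((f.prodCongr f').trans (LinearEquiv.prodProdProdComm R A B A' B'))⟩⟩

end Decomposition

/-! ### Finitely generated injective hulls by coinduction from the base field -/

section FiniteInjective

lemma injective_of_field (k : Type v) [Field k] (V : ModuleCat.{u} k) : Injective V where
  factors g f hf := by
    obtain ⟨r, hr⟩ := LinearMap.exists_leftInverse_of_injective f.hom
      (LinearMap.ker_eq_bot.2 ((ModuleCat.mono_iff_injective f).1 hf))
    refine ⟨ModuleCat.ofHom (g.hom ∘ₗ r), ?_⟩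
    ext x
    exact congrArg g.hom (LinearMap.congr_fun hr x)

/-- Coinduction along `k → R` preserves finite generation. -/
lemma finite_coextendScalars (k : Type v) [Field k] (R : Type u) [Ring R] [Algebra k R]
    [FiniteDimensional k R] (V : ModuleCat.{u} k) [Module.Finite k V] :
    Module.Finite R ((ModuleCat.coextendScalars.{v, u, u} (algebraMap k R)).obj V) := by
  let W := (ModuleCat.restrictScalars (algebraMap k R)).obj (ModuleCat.of R R)
  have hW : Module.Finite k W := Module.Finite.equiv (M := R) (N := W)
    { toFun := fun x => x
      invFun := fun x => x
      map_add' := fun _ _ => rfl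
      map_smul' := fun c x => Algebra.smul_def c x
      left_inv := fun _ => rfl
      right_inv := fun _ => rfl }
  let e := ModuleCat.CoextendScalars.equiv (algebraMap k R) V
  obtain ⟨s, hs⟩ := (Module.Finite.fg_top : (⊤ : Submodule k (W →ₗ[k] V)).FG)
  suffices Module.Finite R (W →ₗ[k] V) from Module.Finite.equiv e.symm
  refine ⟨⟨s, eq_top_iff.2 fun g _ => ?_⟩⟩
  have hg : g ∈ Submodule.span k (s : Set (W →ₗ[k] V)) := hs ▸ Submodule.mem_top
  induction hg using Submodule.span_induction with
  | mem x hx => exact Submodule.subset_span hx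
  | zero => exact zero_mem _
  | add x y _ _ hx hy => exact add_mem (hx trivial) (hy trivial)
  | smul c x _ hx =>
    -- `R` acts by right multiplication on the argument; scalars from `k` are central, so both
    -- actions of `k` agree.
    have : c • x = algebraMap k R c • x := by
      ext w
      exact (x.map_smul c w).symm.trans (congrArg x (Algebra.commutes (A := R) c w))
    rw [this]
    exact Submodule.smul_mem _ _ (hx trivial)

/-- A finitely generated module over a finite-dimensional algebra embeds into a finitely generated
injective one. -/
lemma exists_injective_of_finite (k : Type v) [Field k] (R : Type u) [Ring R] [Algebra k R]
    [FiniteDimensional k R] (N : ModuleCat.{u} R) (hN : Module.Finite R N) :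
    ∃ (I : ModuleCat.{u} R) (f : N ⟶ I), Mono f ∧ Injective I ∧ Module.Finite R I := by
  let V := (ModuleCat.restrictScalars.{u} (algebraMap k R)).obj N
  have hV : Injective V := injective_of_field k V
  have hVf : Module.Finite k V := by
    let _ : Module k N := Module.compHom N (algebraMap k R)
    have : IsScalarTower k R N := ⟨fun c r x => by
      rw [Algebra.smul_def, mul_smul]; rfl⟩
    have h : Module.Finite k N := Module.Finite.trans R N
    exact h
  let adj := ModuleCat.restrictCoextendScalarsAdj.{u} (algebraMap k R)
  refine ⟨(ModuleCat.coextendScalars.{v, u, u} (algebraMap k R)).obj V, adj.unit.app N, ?_,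
    Injective.injective_of_adjoint adj V, finite_coextendScalars k R V⟩
  rw [ModuleCat.mono_iff_injective]
  intro x y hxy
  -- The unit sends `x` to `r ↦ r • x`, so evaluation at `1` recovers `x`.
  have h : (1 : R) • x = (1 : R) • y :=
    congrArg (fun g => ModuleCat.CoextendScalars.equiv (algebraMap k R) V g (1 : R)) hxy
  simpa using h

end FiniteInjective

end RightMod

namespace RightMod

open Abelian

/-! ### Long exact sequences and dimension shifting -/

section Ext

variable {C : Type*} [Category C] [Abelian C] [HasExt.{v} C]

/-- If the identity of `X` is a sum of endomorphisms that factor through `T`, then `Extⁿ(X, Y)`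
vanishes whenever `Extⁿ(T, Y)` does. -/
lemma ext_eq_zero_of_sum_comp_eq_id {X T Y : C} {ι : Type*} [Fintype ι] (p : ι → (X ⟶ T))
    (q : ι → (T ⟶ X)) (h : ∑ i, p i ≫ q i = 𝟙 X) {n : ℕ} (hT : ∀ e : Ext T Y n, e = 0)
    (e : Ext X Y n) : e = 0 := by
  rw [← e.mk₀_id_comp, ← h, Ext.mk₀_sum, Ext.sum_comp]
  refine Finset.sum_eq_zero fun i _ => ?_
  rw [← Ext.mk₀_comp_mk₀_assoc, hT ((Ext.mk₀ (q i)).comp e _), Ext.comp_zero]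

lemma hasProjectiveDimensionLT_of_sum_comp_eq_id {X T : C} {ι : Type*} [Fintype ι]
    (p : ι → (X ⟶ T)) (q : ι → (T ⟶ X)) (h : ∑ i, p i ≫ q i = 𝟙 X) (n : ℕ)
    [HasProjectiveDimensionLT T n] : HasProjectiveDimensionLT X n := by
  rw [hasProjectiveDimensionLT_iff]
  exact fun i hi Y e => ext_eq_zero_of_sum_comp_eq_id p q h
    (fun e => e.eq_zero_of_hasProjectiveDimensionLT n hi) e

variable {S : ShortComplex C} (hS : S.ShortExact)
include hS

/-- As `Ext¹(F, S.X₂) = 0`, each class is the connecting image of a map `F ⟶ S.X₃`, and the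
connecting map kills whatever lifts to `S.X₂`. -/
lemma ext_X₁_eq_zero_of_lift {F : C} [Injective S.X₂]
    (h : ∀ g : F ⟶ S.X₃, ∃ l : F ⟶ S.X₂, l ≫ S.g = g) (e : Ext F S.X₁ 1) : e = 0 := by
  obtain ⟨x, rfl⟩ := Ext.covariant_sequence_exact₁ F hS e (Ext.eq_zero_of_injective _) (zero_add 1)
  obtain ⟨g, rfl⟩ := Ext.homEquiv₀.symm.surjective x
  obtain ⟨l, rfl⟩ := h g
  change (Ext.mk₀ (l ≫ S.g)).comp hS.extClass _ = 0
  rw [← Ext.mk₀_comp_mk₀, Ext.comp_assoc _ _ _ (zero_add 0) (zero_add 1) (by lia),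
    hS.comp_extClass, Ext.comp_zero]

lemma ext_X₁_succ_eq_zero {F : C} [Injective S.X₂] {n : ℕ} (h : ∀ e : Ext F S.X₃ n, e = 0)
    (e : Ext F S.X₁ (n + 1)) : e = 0 := by
  obtain ⟨x, rfl⟩ := Ext.covariant_sequence_exact₁ F hS e (Ext.eq_zero_of_injective _) rfl
  rw [h x, Ext.zero_comp]

lemma ext_X₃_eq_zero {F : C} [Injective S.X₂] {n : ℕ}
    (h : ∀ e : Ext F S.X₁ (n + 2), e = 0) (e : Ext F S.X₃ (n + 1)) : e = 0 := by
  obtain ⟨x, rfl⟩ := Ext.covariant_sequence_exact₃ F hS e rfl (h _)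
  rw [Ext.eq_zero_of_injective x, Ext.zero_comp]

lemma ext_X₁_one_eq_zero_of_projective {N : C} [Projective S.X₂] (h : ∀ e : Ext S.X₃ N 2, e = 0)
    (e : Ext S.X₁ N 1) : e = 0 := by
  obtain ⟨x, rfl⟩ := Ext.contravariant_sequence_exact₁ hS N e (by rfl : 1 + 1 = 2) (h _)
  rw [Ext.eq_zero_of_projective x, Ext.comp_zero]

lemma exists_extension_of_ext_one_eq_zero {N : C} (h : ∀ e : Ext S.X₃ N 1, e = 0)
    (φ : S.X₁ ⟶ N) : ∃ ψ : S.X₂ ⟶ N, S.f ≫ ψ = φ := by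
  obtain ⟨x, hx⟩ := Ext.contravariant_sequence_exact₁ hS N (Ext.mk₀ φ) (add_zero 1) (h _)
  obtain ⟨ψ, rfl⟩ := Ext.homEquiv₀.symm.surjective x
  exact ⟨ψ, Ext.homEquiv₀.symm.injective (by simpa using hx)⟩

lemma exists_lift_of_ext_one_eq_zero {K : C} (h : ∀ e : Ext K S.X₁ 1, e = 0)
    (φ : K ⟶ S.X₃) : ∃ ψ : K ⟶ S.X₂, ψ ≫ S.g = φ := by
  obtain ⟨x, hx⟩ := Ext.covariant_sequence_exact₃ K hS (Ext.mk₀ φ) (zero_add 1) (h _)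
  obtain ⟨ψ, rfl⟩ := Ext.homEquiv₀.symm.surjective x
  exact ⟨ψ, Ext.homEquiv₀.symm.injective (by simpa using hx)⟩

omit hS in
lemma hasProjectiveDimensionLT_of_forall_injectiveDimensionLT (n : ℕ)
    (h : ∀ N : C, HasInjectiveDimensionLT N n) (M : C) : HasProjectiveDimensionLT M n := by
  rw [hasProjectiveDimensionLT_iff]
  exact fun i hi Y e => e.eq_zero_of_hasInjectiveDimensionLT n hi

end Ext

/-! ### Testing homological dimensions on finitely generated modules -/

section ModuleCategory

variable {R : Type u} [Ring R]

lemma exists_free_presentation (M : ModuleCat.{u} R) [Module.Finite R M] :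
    ∃ (n : ℕ) (g : (Fin n → R) →ₗ[R] M), g.shortComplexKer.ShortExact := by
  obtain ⟨n, g, hg⟩ := Module.Finite.exists_fin' R M
  exact ⟨n, g, LinearMap.shortExact_shortComplexKer hg⟩

instance (n : ℕ) : Projective (ModuleCat.of R (Fin n → R)) :=
  (IsProjective.iff_projective (R := R) (Fin n → R)).1 inferInstance

/-- Over a noetherian ring, projectivity of a finitely generated module is tested on `Ext¹` with
values in finitely generated modules. -/
lemma projective_of_ext_finite [IsNoetherianRing R] (K : ModuleCat.{u} R) [Module.Finite R K]
    (h : ∀ N : ModuleCat.{u} R, Module.Finite R N → ∀ e : Ext K N 1, e = 0) : Projective K := by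
  obtain ⟨n, g, hg⟩ := exists_free_presentation K
  -- The syzygy is finitely generated by noetherianity, so the hypothesis applies to it and the
  -- identity of `K` lifts to the free module.
  obtain ⟨s, hs⟩ := exists_lift_of_ext_one_eq_zero hg
    (h (ModuleCat.of R (LinearMap.ker g)) (Module.IsNoetherian.finite R (LinearMap.ker g))) (𝟙 K)
  have : Projective g.shortComplexKer.X₂ :=
    inferInstanceAs (Projective (ModuleCat.of R (Fin n → R)))
  exact (Retract.mk s g.shortComplexKer.g hs).projective

/-- The first syzygy is projective, because its `Ext¹` embeds in `Ext²` of `F`. -/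
lemma hasProjectiveDimensionLT_two_of_ext_finite [IsNoetherianRing R] (F : ModuleCat.{u} R)
    [Module.Finite R F]
    (h : ∀ N : ModuleCat.{u} R, Module.Finite R N → ∀ e : Ext F N 2, e = 0) :
    HasProjectiveDimensionLT F 2 := by
  obtain ⟨n, g, hg⟩ := exists_free_presentation F
  have : Projective g.shortComplexKer.X₂ :=
    inferInstanceAs (Projective (ModuleCat.of R (Fin n → R)))
  have : Module.Finite R g.shortComplexKer.X₁ := Module.IsNoetherian.finite R (LinearMap.ker g)
  have : Projective g.shortComplexKer.X₁ := projective_of_ext_finite _ fun N hN =>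
    ext_X₁_one_eq_zero_of_projective hg (h N hN)
  exact hg.hasProjectiveDimensionLT_X₃ 1 inferInstance inferInstance

/-- Baer's criterion only involves extensions along `I ⊆ R`, whose obstructions lie in `Ext¹(R ⧸ I,
Q)` with `R ⧸ I` cyclic. -/
lemma injective_of_ext_finite (Q : ModuleCat.{u} R)
    (h : ∀ M : ModuleCat.{u} R, Module.Finite R M → ∀ e : Ext M Q 1, e = 0) : Injective Q := by
  have hQ : Module.Baer R Q := fun I g => by
    have hS := LinearMap.shortExact_shortComplexKer (Submodule.mkQ_surjective I)
    obtain ⟨ψ, hψ⟩ := exists_extension_of_ext_one_eq_zero hS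
      (h (ModuleCat.of R (R ⧸ I)) (inferInstanceAs (Module.Finite R (R ⧸ I))))
      (ModuleCat.ofHom (g ∘ₗ (LinearEquiv.ofEq _ _ I.ker_mkQ).toLinearMap))
    exact ⟨ψ.hom, fun x hx => congrArg
      (fun f => f.hom (⟨x, by simpa using hx⟩ : LinearMap.ker I.mkQ)) hψ⟩
  have := hQ.injective
  exact Module.injective_object_of_injective_module R Q

/-- A bound for the projective dimensions of the finitely generated modules bounds the projective
dimensions of all modules. -/
lemma hasProjectiveDimensionLT_three_of_finite
    (h : ∀ M : ModuleCat.{u} R, Module.Finite R M → HasProjectiveDimensionLT M 3)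
    (M : ModuleCat.{u} R) : HasProjectiveDimensionLT M 3 := by
  have key : ∀ N : ModuleCat.{u} R, ∃ S : ShortComplex (ModuleCat.{u} R),
      S.ShortExact ∧ S.X₁ = N ∧ Injective S.X₂ := fun N => by
    obtain ⟨p⟩ := EnoughInjectives.presentation N
    exact ⟨ShortComplex.mk _ _ (Limits.cokernel.condition p.f),
      { exact := ShortComplex.exact_cokernel p.f }, rfl, p.injective⟩
  refine hasProjectiveDimensionLT_of_forall_injectiveDimensionLT 3 (fun N => ?_) M
  obtain ⟨S, hS, rfl, hI⟩ := key N
  obtain ⟨S', hS', hSS', hI'⟩ := key S.X₃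
  -- The second cosyzygy of `S.X₁` is injective: its `Ext¹` from a finitely generated `M` shifts to
  -- `Ext³(M, S.X₁) = 0`.
  have : Injective S'.X₃ := injective_of_ext_finite _ fun M hM =>
    ext_X₃_eq_zero hS' (n := 0) <| hSS' ▸ ext_X₃_eq_zero hS (n := 1) fun e =>
      have := h M hM
      e.eq_zero_of_hasProjectiveDimensionLT 3 le_rfl
  refine (hS.hasInjectiveDimensionLT_X₃_iff 1 hI).1 ?_
  rw [← hSS']
  exact (hS'.hasInjectiveDimensionLT_X₃_iff 0 hI').1 inferInstance

end ModuleCategory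

end RightMod

namespace RightMod

open Abelian

/-! ### Separating tilting modules -/

section Tilting

variable {Λ : Type u} [Ring Λ]

/-- The form in which membership in `add T` is used: vanishing of `Ext` and generation pass from `T`
to `X` along these factorizations. -/
lemma InAdd.exists_sum_comp_eq_id {T X : RightMod Λ} (h : InAdd T X) :
    ∃ (n : ℕ) (p : Fin n → (X ⟶ T)) (q : Fin n → (T ⟶ X)), ∑ i, p i ≫ q i = 𝟙 X := by
  obtain ⟨n, N, hN, ⟨e⟩⟩ := h
  choose N' hN' using hN
  let p (i : Fin n) : X →ₗ[Λᵐᵒᵖ] T := (N i).subtype ∘ₗ LinearMap.proj i ∘ₗ e.toLinearMap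
  let q (i : Fin n) : T →ₗ[Λᵐᵒᵖ] X :=
    e.symm.toLinearMap ∘ₗ LinearMap.single Λᵐᵒᵖ (fun i => N i) i ∘ₗ
      (N i).projectionOnto (N' i) (hN' i)
  refine ⟨n, fun i => ModuleCat.ofHom (p i), fun i => ModuleCat.ofHom (q i), ?_⟩
  ext x
  have h1 : ∀ i, q i (p i x) = e.symm (Pi.single i (e x i)) := fun i => by
    simp [p, q, Submodule.projectionOnto_apply_left]
  have h2 : ∑ i, q i (p i x) = x := by
    simp_rw [h1]
    rw [← map_sum, Finset.univ_sum_single, e.symm_apply_apply]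
  simpa [ModuleCat.hom_sum, LinearMap.sum_apply] using h2

lemma InAdd.ext_eq_zero {T X Y : RightMod Λ} (h : InAdd T X) {n : ℕ}
    (hT : ∀ e : Ext T Y n, e = 0) (e : Ext X Y n) : e = 0 := by
  obtain ⟨_, p, q, hpq⟩ := h.exists_sum_comp_eq_id
  exact ext_eq_zero_of_sum_comp_eq_id p q hpq hT e

lemma InAdd.hasProjectiveDimensionLT {T X : RightMod Λ} (h : InAdd T X) (n : ℕ)
    [HasProjectiveDimensionLT T n] : HasProjectiveDimensionLT X n := by
  obtain ⟨_, p, q, hpq⟩ := h.exists_sum_comp_eq_id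
  exact hasProjectiveDimensionLT_of_sum_comp_eq_id p q hpq n

lemma InAdd.isGeneratedBy {T X : RightMod Λ} (h : InAdd T X) : IsGeneratedBy Λᵐᵒᵖ T X := by
  obtain ⟨n, p, q, hpq⟩ := h.exists_sum_comp_eq_id
  rw [IsGeneratedBy, eq_top_iff]
  intro x _
  have hx : ∑ i, (q i).hom ((p i).hom x) = x := by
    simpa [ModuleCat.hom_sum, LinearMap.sum_apply] using congrArg (fun f => f.hom x) hpq
  rw [← hx]
  exact sum_mem fun i _ => Submodule.mem_iSup_of_mem (q i).hom ⟨_, rfl⟩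

variable {T : RightMod Λ}

lemma IsTilting.hasProjectiveDimensionLT (hT : IsTilting T) : HasProjectiveDimensionLT T 2 :=
  (projectiveDimension_le_iff T 1).1 hT.projectiveDimension_le

/-- Modules in the torsion class are generated by the tilting module. -/
lemma IsTilting.isGeneratedBy_of_torsionClass (hT : IsTilting T) {M : RightMod Λ}
    (hM : torsionClass T M) : IsGeneratedBy Λᵐᵒᵖ T M := by
  obtain ⟨T', T'', h', h'', f, g, w, hS⟩ := hT.coresolution
  have := hM.2
  rw [IsGeneratedBy, eq_top_iff]
  intro m _
  let φ : Λ →ₗ[Λᵐᵒᵖ] M :=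
    { toFun := fun a => MulOpposite.op a • m
      map_add' := fun a b => by rw [MulOpposite.op_add, add_smul]
      map_smul' := fun r a => by
        rw [RingHom.id_apply, ← mul_smul]
        rfl }
  -- The map `1 ↦ m` extends to `T'` because `Ext¹(T'', M) = 0`, so `m` lies in the image of a
  -- module generated by `T`.
  obtain ⟨ψ, hψ⟩ := exists_extension_of_ext_one_eq_zero hS
    (h''.ext_eq_zero fun e => Subsingleton.elim e 0) (ModuleCat.ofHom φ)
  refine (h'.isGeneratedBy.map_le ψ.hom) ⟨f.hom (1 : Λ), ?_⟩
  refine (congrArg (fun f => f.hom (1 : Λ)) hψ).trans ?_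
  exact one_smul Λᵐᵒᵖ m

/-- The cokernel of an embedding into a finitely generated injective module is torsion. -/
lemma IsTilting.torsionClass_X₃ (hT : IsTilting T) {S : ShortComplex (RightMod Λ)}
    (hS : S.ShortExact) [Injective S.X₂] (hf : Module.Finite Λᵐᵒᵖ S.X₂) : torsionClass T S.X₃ := by
  have := hT.hasProjectiveDimensionLT
  refine ⟨Module.Finite.of_surjective S.g.hom hS.moduleCat_surjective_g, ⟨fun a b => ?_⟩⟩
  have h := ext_X₃_eq_zero hS (F := T) (n := 0)
    fun e => e.eq_zero_of_hasProjectiveDimensionLT 2 le_rfl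
  rw [h a, h b]

lemma IsTilting.hasProjectiveDimensionLT_of_isGeneratedBy (hT : IsTilting T)
    (hH : HasHereditaryProperty T) {M : RightMod Λ} (hf : Module.Finite Λᵐᵒᵖ M)
    (hM : IsGeneratedBy Λᵐᵒᵖ T M) : HasProjectiveDimensionLT M 3 := by
  have := hT.hasProjectiveDimensionLT
  obtain ⟨T', T'', h', h'', f, g, w, hS⟩ := hH M ⟨hf, hM.exists_surjective⟩
  have := h''.hasProjectiveDimensionLT 2
  exact hS.hasProjectiveDimensionLT_X₃ 2 (h'.hasProjectiveDimensionLT 2)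
    (hasProjectiveDimensionLT_of_ge T'' 2 3 (by lia))

variable [IsArtinianRing Λᵐᵒᵖ]

/-- If `T` is separating, every finitely generated module is the direct sum of a module generated
by `T` and of a torsion-free module. -/
lemma IsTilting.exists_decomposition (hT : IsTilting T) (hs : IsSeparating T) (E : RightMod Λ)
    (hE : Module.Finite Λᵐᵒᵖ E) :
    ∃ A B : RightMod Λ, IsGeneratedBy Λᵐᵒᵖ T A ∧ (∀ f : T →ₗ[Λᵐᵒᵖ] B, f = 0) ∧
      Nonempty (E ≃ₗ[Λᵐᵒᵖ] A × B) := by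
  -- Generation by `T` replaces membership in the torsion class: it is what the Hom-vanishing
  -- arguments use, and it passes directly to products.
  refine exists_prod_of_indecomposable (fun A => IsGeneratedBy Λᵐᵒᵖ T A)
    (fun B => ∀ f : T →ₗ[Λᵐᵒᵖ] B, f = 0) (fun X _ => ?_) (fun X _ f => ?_)
    (fun X Y hX hY => hX.prod hY) (fun X Y hX hY f => ?_) (fun X hX hi => ?_) E hE
  · exact Subsingleton.elim (α := Submodule Λᵐᵒᵖ X) _ _
  · ext x
    exact Subsingleton.elim (α := X) _ _
  · ext x
    · exact LinearMap.congr_fun (hX (LinearMap.fst _ _ _ ∘ₗ f)) x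
    · exact LinearMap.congr_fun (hY (LinearMap.snd _ _ _ ∘ₗ f)) x
  · refine (hs X hX hi).imp hT.isGeneratedBy_of_torsionClass fun h f => ?_
    exact congrArg ModuleCat.Hom.hom (h.2 (ModuleCat.ofHom f))

variable (k : Type v) [Field k] [Algebra k Λᵐᵒᵖ] [FiniteDimensional k Λᵐᵒᵖ]

include k in
/-- There are no nontrivial extensions of torsion-free modules by torsion modules if the torsion
pair splits. -/
lemma IsTilting.ext_one_eq_zero (hT : IsTilting T) (hs : IsSeparating T) {F M : RightMod Λ}
    (hFf : Module.Finite Λᵐᵒᵖ F) (hF : ∀ f : T →ₗ[Λᵐᵒᵖ] F, f = 0) (hM : torsionClass T M)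
    (e : Ext F M 1) : e = 0 := by
  obtain ⟨I, f, hf, hI, hIf⟩ := exists_injective_of_finite k Λᵐᵒᵖ M hM.1
  have hS : (ShortComplex.mk f _ (Limits.cokernel.condition f)).ShortExact :=
    { exact := ShortComplex.exact_cokernel f }
  refine ext_X₁_eq_zero_of_lift hS (fun g => ?_) e
  let p := (Limits.cokernel.π f).hom
  -- By exactness the kernel is the image of the torsion module `M`.
  have hK : IsGeneratedBy Λᵐᵒᵖ T (LinearMap.ker p) := by
    have hex := (ShortComplex.ShortExact.moduleCat_exact_iff_function_exact _).1 hS.exact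
    refine (hT.isGeneratedBy_of_torsionClass hM).of_surjective
      (f.hom.codRestrict (LinearMap.ker p) fun x => (hex _).2 ⟨x, rfl⟩) ?_
    rintro ⟨y, hy⟩
    obtain ⟨x, rfl⟩ := (hex y).1 hy
    exact ⟨x, rfl⟩
  let E := LinearMap.eqLocus (p ∘ₗ LinearMap.fst Λᵐᵒᵖ I F) (g.hom ∘ₗ LinearMap.snd Λᵐᵒᵖ I F)
  obtain ⟨A, B, hA, hB, ⟨e⟩⟩ := hT.exists_decomposition hs (ModuleCat.of Λᵐᵒᵖ E)
    (Module.IsNoetherian.finite Λᵐᵒᵖ E)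
  obtain ⟨l, hl⟩ := exists_lift_of_isGeneratedBy p hS.moduleCat_surjective_g hK g.hom hF e hA hB
  exact ⟨ModuleCat.ofHom l, ModuleCat.hom_ext hl⟩

include k in
-- `Ext²(F, N)` shifts to `Ext¹(F, I/N)` for an injective `I` containing `N`, and `I/N` is torsion.
lemma IsTilting.hasProjectiveDimensionLT_of_torsionFree (hT : IsTilting T) (hs : IsSeparating T)
    {F : RightMod Λ} (hFf : Module.Finite Λᵐᵒᵖ F) (hF : ∀ f : T →ₗ[Λᵐᵒᵖ] F, f = 0) :
    HasProjectiveDimensionLT F 2 := by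
  refine hasProjectiveDimensionLT_two_of_ext_finite F fun N hN => ?_
  obtain ⟨I, f, hf, hI, hIf⟩ := exists_injective_of_finite k Λᵐᵒᵖ N hN
  have hS : (ShortComplex.mk f _ (Limits.cokernel.condition f)).ShortExact :=
    { exact := ShortComplex.exact_cokernel f }
  exact ext_X₁_succ_eq_zero hS (n := 1)
    (hT.ext_one_eq_zero k hs hFf hF (hT.torsionClass_X₃ hS hIf))

include k in
lemma IsTilting.hasProjectiveDimensionLT_three (hT : IsTilting T) (hs : IsSeparating T)
    (hH : HasHereditaryProperty T) (M : RightMod Λ) : HasProjectiveDimensionLT M 3 := by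
  refine hasProjectiveDimensionLT_three_of_finite (fun M hM => ?_) M
  obtain ⟨A, B, hA, hB, ⟨e⟩⟩ := hT.exists_decomposition hs M hM
  have hAf : Module.Finite Λᵐᵒᵖ A := Module.Finite.of_surjective
    (LinearMap.fst Λᵐᵒᵖ A B ∘ₗ e.toLinearMap) (Prod.fst_surjective.comp e.surjective)
  have hBf : Module.Finite Λᵐᵒᵖ B := Module.Finite.of_surjective
    (LinearMap.snd Λᵐᵒᵖ A B ∘ₗ e.toLinearMap) (Prod.snd_surjective.comp e.surjective)
  have := hT.hasProjectiveDimensionLT_of_isGeneratedBy hH hAf hA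
  have := hT.hasProjectiveDimensionLT_of_torsionFree k hs hBf hB
  have : HasProjectiveDimensionLT B 3 := hasProjectiveDimensionLT_of_ge B 2 3 (by lia)
  exact hasProjectiveDimensionLT_of_iso
    (ModuleCat.biprodIsoProd A B ≪≫ e.symm.toModuleIso) 3

end Tilting

end RightMod

theorem mainTheorem6 (k : Type v) [Field k] [IsAlgClosed k]
    (Λ : Type u) [Ring Λ] [Algebra k Λ] [FiniteDimensional k Λ]
    (h : ∃ T : RightMod Λ, RightMod.IsTilting T ∧ RightMod.IsSeparating T ∧
      RightMod.HasHereditaryProperty T) :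
    RightMod.globalDimension Λ ≤ 2 := by
  obtain ⟨T, hT, hs, hH⟩ := h
  have : FiniteDimensional k Λᵐᵒᵖ := Module.Finite.equiv (MulOpposite.opLinearEquiv k)
  have : IsArtinianRing Λᵐᵒᵖ := IsArtinianRing.of_finite k Λᵐᵒᵖ
  exact iSup_le fun M => (projectiveDimension_le_iff M 2).2
    (hT.hasProjectiveDimensionLT_three k hs hH M)
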